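/- Let $S$ be a compact connected orientable surface, possibly with boundary, different from the disc and from the sphere, and let $\Pi:\tilde S\to S$ be its universal cover, where $\tilde S$ is realised as a subset of the Euclidean plane $\mathbb{R}^2$ or of the hyperbolic plane $\mathbb{H}^2$ in such a way that the deck transformations are isometries of $\tilde S$ for the Euclidean, respectively hyperbolic, distance. For $A\subset\tilde S$ let $\delta(A)$ be the diameter of $A$ for this distance. A fundamental domain is a compact connected subset $D\subset\tilde S$ with $\Pi(D)=S$ such that the interiors of $D$ and $\gamma(D)$ are disjoint for every deck transformation $\gamma\neq\mathrm{id}$. Let $\mathrm{Homeo}_0(S)$ be the identity component of the group of homeomorphisms of $S$ (with the topology of uniform convergence), and $\mathrm{Homeo}_0(S,\partial S)$ the identity component of the group of homeomorphisms of $S$ that fix pointwise a neighbourhood of $\partial S$. For $f$ in $\mathrm{Homeo}_0(S)$ (respectively in $\mathrm{Homeo}_0(S,\partial S)$) let $\tilde f$ be the time-one map of a lift to $\tilde S$, equal to the identity at time $0$, of an isotopy (respectively of an isotopy fixing $\partial S$ pointwise) from $\mathrm{id}_S$ to $f$. An element $g$ of a group $G$ is a distortion element of $G$ if there is a finite set $T\subset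 G$ such that $g$ belongs to the subgroup generated by $T$ and $l_T(g^n)/n\to 0$ as $n\to+\infty$, where $l_T(h)$ is the minimal length of a word in the elements of $T$ and their inverses that represents $h$. If $f\in\mathrm{Homeo}_0(S)$ (respectively $f\in\mathrm{Homeo}_0(S,\partial S)$) is a distortion element of $\mathrm{Homeo}_0(S)$ (respectively of $\mathrm{Homeo}_0(S,\partial S)$), then for every fundamental domain $D$ and every such $\tilde f$, $$\lim_{n\to+\infty}\frac{\delta(\tilde f^{\,n}(D))}{n}=0.$$ -/

import Mathlib

open Set Filter Topology
open scoped Manifold unitInterval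

namespace SurfaceDistortion

/-! ### Distortion elements of a group -/

section Distortion

variable {G : Type*} [Group G]

/-- The word length of `g` with respect to `T`: the least length of a word in the elements of `T`
and their inverses whose product is `g`. -/
noncomputable def wordLength (T : Set G) (g : G) : ℕ :=
  sInf {n : ℕ | ∃ w : List G, w.length = n ∧ (∀ s ∈ w, s ∈ T ∨ s⁻¹ ∈ T) ∧ w.prod = g}

/-- `g` is a distortion element of `G`: it lies in a subgroup generated by a finite set `T`, and its
word length satisfies `l_T (g ^ n) / n → 0`. -/
def IsDistortionElement (g : G) : Prop :=
  ∃ T : Set G, T.Finite ∧ g ∈ Subgroup.closure T ∧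
    Tendsto (fun n : ℕ => (wordLength T (g ^ n) : ℝ) / (n : ℝ)) atTop (𝓝 0)

end Distortion

/-! ### Groups of homeomorphisms and isotopies -/

section Homeo

variable {X : Type*} [TopologicalSpace X]

/-- The compact-open topology on the group of homeomorphisms of `X` (for compact `X`, the topology
of uniform convergence). -/
instance homeoTopology : TopologicalSpace (X ≃ₜ X) :=
  TopologicalSpace.induced (fun f : X ≃ₜ X => (f : C(X, X))) inferInstance

theorem continuous_mul_left_homeo (f : X ≃ₜ X) : Continuous (fun g : X ≃ₜ X => f * g) := by
  rw [continuous_induced_rng]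
  have h : Continuous (fun g : X ≃ₜ X => (g : C(X, X))) := continuous_induced_dom
  exact (ContinuousMap.continuous_postcomp (f : C(X, X))).comp h

/-- Left translates by elements of `H` of the connected component of the identity of `H` which
contain the identity stay inside that component. -/
theorem image_mul_left_subset (H : Subgroup (X ≃ₜ X)) {f : X ≃ₜ X} (hf : f ∈ H)
    (h : (1 : X ≃ₜ X) ∈ (fun g => f * g) '' connectedComponentIn (H : Set (X ≃ₜ X)) 1) :
    (fun g => f * g) '' connectedComponentIn (H : Set (X ≃ₜ X)) 1 ⊆
      connectedComponentIn (H : Set (X ≃ₜ X)) 1 := by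
  refine IsPreconnected.subset_connectedComponentIn
    (isPreconnected_connectedComponentIn.image _ (continuous_mul_left_homeo f).continuousOn) h ?_
  rintro _ ⟨g, hg, rfl⟩
  exact H.mul_mem hf (connectedComponentIn_subset _ _ hg)

/-- The inverse of an element of the component of the identity lies in that component. -/
theorem inv_mem_component (H : Subgroup (X ≃ₜ X)) {f : X ≃ₜ X}
    (hf : f ∈ connectedComponentIn (H : Set (X ≃ₜ X)) 1) :
    f⁻¹ ∈ connectedComponentIn (H : Set (X ≃ₜ X)) 1 := by
  have h1 : (1 : X ≃ₜ X) ∈ connectedComponentIn (H : Set (X ≃ₜ X)) 1 :=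
    mem_connectedComponentIn H.one_mem
  have hfH : f ∈ H := connectedComponentIn_subset _ _ hf
  exact image_mul_left_subset H (H.inv_mem hfH) ⟨f, hf, inv_mul_cancel f⟩ ⟨1, h1, mul_one _⟩

/-- The identity component (the connected component of the identity) of a group `H` of
homeomorphisms of `X`, for the compact-open topology. -/
def identityComponent (H : Subgroup (X ≃ₜ X)) : Subgroup (X ≃ₜ X) where
  carrier := connectedComponentIn (H : Set (X ≃ₜ X)) 1
  one_mem' := mem_connectedComponentIn H.one_mem
  mul_mem' {f g} hf hg :=
    image_mul_left_subset H (connectedComponentIn_subset _ _ hf)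
      ⟨f⁻¹, inv_mem_component H hf, mul_inv_cancel f⟩ ⟨g, hg, rfl⟩
  inv_mem' hf := inv_mem_component H hf

/-- The group of homeomorphisms of `X` which fix pointwise a neighbourhood of `A`. -/
def fixingNhdsOf (A : Set X) : Subgroup (X ≃ₜ X) where
  carrier := {f | ∃ U : Set X, IsOpen U ∧ A ⊆ U ∧ ∀ x ∈ U, f x = x}
  one_mem' := ⟨univ, isOpen_univ, subset_univ _, fun _ _ => rfl⟩
  mul_mem' := by
    rintro f g ⟨U, hU, hAU, hf⟩ ⟨V, hV, hAV, hg⟩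
    refine ⟨U ∩ V, hU.inter hV, subset_inter hAU hAV, fun x hx => ?_⟩
    change f (g x) = x
    rw [hg x hx.2, hf x hx.1]
  inv_mem' := by
    rintro f ⟨U, hU, hAU, hf⟩
    refine ⟨U, hU, hAU, fun x hx => ?_⟩
    change f.symm x = x
    rw [Homeomorph.symm_apply_eq, hf x hx]

/-- `φ` is an isotopy between `f` and `g` relative to `A`: a continuous path of homeomorphisms from
`f` to `g`, each of which fixes `A` pointwise. -/
structure IsIsotopyRel (A : Set X) (f g : X ≃ₜ X) (φ : I → (X ≃ₜ X)) : Prop where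
  continuous : Continuous φ
  map_zero : φ 0 = f
  map_one : φ 1 = g
  fix : ∀ t, ∀ x ∈ A, φ t x = x

end Homeo

/-- `Homeo₀(S)`, for a compact surface `S`: the identity component of the group of homeomorphisms
of `S`. -/
def Homeo₀ (S : Type*) [TopologicalSpace S] : Subgroup (S ≃ₜ S) :=
  identityComponent ⊤

/-- The boundary of a surface. -/
def surfaceBoundary (S : Type*) [TopologicalSpace S] [ChartedSpace (EuclideanHalfSpace 2) S] :
    Set S :=
  (𝓡∂ 2).boundary S

/-- `Homeo₀(S, ∂S)`, for a compact surface `S`: the identity component of the group of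
homeomorphisms of `S` which fix pointwise a neighbourhood of the boundary. -/
def Homeo₀Rel (S : Type*) [TopologicalSpace S] [ChartedSpace (EuclideanHalfSpace 2) S] :
    Subgroup (S ≃ₜ S) :=
  identityComponent (fixingNhdsOf (surfaceBoundary S))

/-! ### The universal cover as a subset of the euclidean or of the hyperbolic plane -/

/-- The two plane geometries. -/
inductive PlaneGeometry
  | euclidean
  | hyperbolic

/-- The euclidean plane `ℝ²`, respectively the hyperbolic plane `ℍ²`. -/
def PlaneGeometry.Plane : PlaneGeometry → Type
  | .euclidean => EuclideanSpace ℝ (Fin 2)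
  | .hyperbolic => UpperHalfPlane

/-- The euclidean, respectively hyperbolic, distance. -/
noncomputable instance PlaneGeometry.instMetricSpace : (g : PlaneGeometry) → MetricSpace g.Plane
  | .euclidean => inferInstanceAs (MetricSpace (EuclideanSpace ℝ (Fin 2)))
  | .hyperbolic => inferInstanceAs (MetricSpace UpperHalfPlane)

/-- A universal cover `Π : S̃ → S`, where `S̃` is a subset of the euclidean plane or of the hyperbolic
plane, endowed with the euclidean or hyperbolic distance, and where the deck transformations are
isometries. -/
structure PlanarUniversalCover (S : Type*) [TopologicalSpace S] where
  /-- the geometry of the ambient plane -/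
  geometry : PlaneGeometry
  /-- the total space, a subset of the plane -/
  total : Set geometry.Plane
  /-- the covering projection -/
  proj : total → S
  isCoveringMap : IsCoveringMap proj
  simplyConnected : SimplyConnectedSpace total
  isometry_of_deck : ∀ γ : total ≃ₜ total, (∀ x, proj (γ x) = proj x) → Isometry γ

namespace PlanarUniversalCover

variable {S : Type*} [TopologicalSpace S] (P : PlanarUniversalCover S)

/-- The group of deck transformations, that is, the fundamental group of `S`. -/
def deckGroup : Subgroup (P.total ≃ₜ P.total) where
  carrier := {γ | ∀ x, P.proj (γ x) = P.proj x}
  one_mem' _ := rfl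
  mul_mem' {γ γ'} h h' x := (h (γ' x)).trans (h' x)
  inv_mem' {γ} h x := by
    have := h (γ.symm x)
    rw [Homeomorph.apply_symm_apply] at this
    exact this.symm

/-- A fundamental domain: a compact connected subset `D` of `S̃` with `Π(D) = S` whose interior is
disjoint from the interior of `γ(D)` for every nontrivial deck transformation `γ`. -/
structure IsFundamentalDomain (D : Set P.total) : Prop where
  isCompact : IsCompact D
  isConnected : IsConnected D
  image_proj : P.proj '' D = univ
  disjoint_interior : ∀ γ ∈ P.deckGroup, γ ≠ 1 → Disjoint (interior D) (interior (γ '' D))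

/-- The homeomorphism `F` of `S̃` is a lift of the homeomorphism `f` of `S`. -/
def IsLift (f : S ≃ₜ S) (F : P.total ≃ₜ P.total) : Prop :=
  ∀ x, P.proj (F x) = f (P.proj x)

/-- `F` is the time one of a lift, equal to the identity at time `0`, of an isotopy relative to `A`
between the identity of `S` and `f`. -/
def IsIsotopyLift (A : Set S) (f : S ≃ₜ S) (F : P.total ≃ₜ P.total) : Prop :=
  ∃ (φ : I → (S ≃ₜ S)) (Φ : I → (P.total ≃ₜ P.total)),
    IsIsotopyRel A 1 f φ ∧ Continuous Φ ∧ (∀ t, P.IsLift (φ t) (Φ t)) ∧ Φ 0 = 1 ∧ Φ 1 = F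

end PlanarUniversalCover

end SurfaceDistortion

namespace SurfaceDistortion

/-! ### Word length and displacement -/

section WordLength

variable {G : Type*} [Group G]

/-! Displacement of lifts is subadditive under composition. If each of the finitely many generators
has a lift moving points by at most `C`, then `f ^ n` has a lift within `C * wordLength T (f ^ n)`
of the identity. Any other lift of `f ^ n`, such as `F ^ n`, differs from it by an isometric deck
transformation, so `diam (F ^ n '' D) ≤ diam D + 2 * C * wordLength T (f ^ n)`, which is `o(n)`.

Generators do have such lifts: homeomorphisms with a lift at bounded distance from the identity form
a subgroup, which by cocompactness is a neighbourhood of `1` (`boundedLiftSubgroup_mem_nhds_one`).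
It is therefore clopen and contains both identity components. -/

/-- An element of the subgroup generated by `T` is the product of a word of length
`wordLength T g`. -/
theorem exists_list_length_eq_wordLength {T : Set G} {g : G} (hg : g ∈ Subgroup.closure T) :
    ∃ w : List G, w.length = wordLength T g ∧ (∀ s ∈ w, s ∈ T ∨ s⁻¹ ∈ T) ∧ w.prod = g := by
  rw [← Subgroup.mem_toSubmonoid, Subgroup.closure_toSubmonoid] at hg
  obtain ⟨w, hw, hprod⟩ := Submonoid.exists_list_of_mem_closure hg
  -- Since `sInf ∅ = 0` in `ℕ`, the minimum is attained only because `g` is represented by some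
  -- word.
  exact Nat.sInf_mem (s := {n : ℕ | ∃ w : List G, w.length = n ∧
    (∀ s ∈ w, s ∈ T ∨ s⁻¹ ∈ T) ∧ w.prod = g}) ⟨w.length, w, rfl, hw, hprod⟩

end WordLength

/-! ### Lifts at bounded distance from the identity -/

section BoundedLift

variable {X S : Type*} [MetricSpace X] [TopologicalSpace S] {p : X → S}

/-- The homeomorphism `f` has a lift through `p` which moves points by at most `M`. -/
def HasLiftWithin (p : X → S) (M : ℝ) (f : S ≃ₜ S) : Prop :=
  ∃ F : X ≃ₜ X, (∀ x, p (F x) = f (p x)) ∧ ∀ x, dist (F x) x ≤ M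

theorem HasLiftWithin.one : HasLiftWithin p 0 1 :=
  ⟨1, fun _ => rfl, fun x => (dist_self x).le⟩

theorem HasLiftWithin.mono {M N : ℝ} {f : S ≃ₜ S} (hf : HasLiftWithin p M f) (h : M ≤ N) :
    HasLiftWithin p N f := by
  obtain ⟨F, hF, hM⟩ := hf
  exact ⟨F, hF, fun x => (hM x).trans h⟩

theorem HasLiftWithin.mul {M N : ℝ} {f g : S ≃ₜ S} (hf : HasLiftWithin p M f)
    (hg : HasLiftWithin p N g) : HasLiftWithin p (M + N) (f * g) := by
  obtain ⟨F, hF, hM⟩ := hf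
  obtain ⟨G, hG, hN⟩ := hg
  refine ⟨F * G, fun x => ?_, fun x => ?_⟩
  · change p (F (G x)) = f (g (p x))
    rw [hF, hG]
  · exact (dist_triangle (F (G x)) (G x) x).trans (add_le_add (hM _) (hN _))

theorem HasLiftWithin.inv {M : ℝ} {f : S ≃ₜ S} (hf : HasLiftWithin p M f) :
    HasLiftWithin p M f⁻¹ := by
  obtain ⟨F, hF, hM⟩ := hf
  refine ⟨F⁻¹, fun x => ?_, fun x => ?_⟩
  · change p (F.symm x) = f.symm (p x)
    rw [Homeomorph.eq_symm_apply, ← hF, Homeomorph.apply_symm_apply]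
  · change dist (F.symm x) x ≤ M
    simpa [dist_comm] using hM (F.symm x)

theorem HasLiftWithin.list_prod {M : ℝ} (w : List (S ≃ₜ S)) (hw : ∀ s ∈ w, HasLiftWithin p M s) :
    HasLiftWithin p (w.length * M) w.prod := by
  induction w with
  | nil => simpa using HasLiftWithin.one
  | cons a w ih =>
    have h := (hw a (by simp)).mul (ih fun s hs => hw s (by simp [hs]))
    rw [List.prod_cons]
    exact h.mono (by push_cast [List.length_cons]; linarith)

/-- The homeomorphisms having a lift at bounded distance from the identity form a group. -/
def boundedLiftSubgroup (p : X → S) : Subgroup (S ≃ₜ S) where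
  carrier := {f | ∃ M, HasLiftWithin p M f}
  one_mem' := ⟨0, HasLiftWithin.one⟩
  mul_mem' := fun ⟨M, hf⟩ ⟨N, hg⟩ => ⟨M + N, hf.mul hg⟩
  inv_mem' := fun ⟨M, hf⟩ => ⟨M, hf.inv⟩

/-- If deck transformations are isometries, a lift of `f` distorts diameters as little as any other
lift of `f`, in particular as one which is close to the identity. -/
theorem diam_image_le_of_hasLiftWithin
    (hiso : ∀ γ : X ≃ₜ X, (∀ x, p (γ x) = p x) → Isometry γ)
    {D : Set X} (hD : Bornology.IsBounded D) {M : ℝ} (hM : 0 ≤ M) {f : S ≃ₜ S}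
    (hf : HasLiftWithin p M f) {F : X ≃ₜ X} (hF : ∀ x, p (F x) = f (p x)) :
    Metric.diam (F '' D) ≤ Metric.diam D + 2 * M := by
  obtain ⟨W, hW, hWM⟩ := hf
  -- Two lifts of `f` differ by a deck transformation, so `F '' D` and `W '' D` are isometric.
  have hγ : Isometry (F * W⁻¹ : X ≃ₜ X) := hiso _ fun x => by
    change p (F (W.symm x)) = p x
    rw [hF, ← hW, Homeomorph.apply_symm_apply]
  have himage : F '' D = (F * W⁻¹ : X ≃ₜ X) '' (W '' D) := by
    rw [image_image]
    refine image_congr fun x _ => ?_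
    change F x = F (W.symm (W x))
    rw [Homeomorph.symm_apply_apply]
  rw [himage, hγ.diam_image]
  refine Metric.diam_le_of_forall_dist_le (by positivity) ?_
  rintro _ ⟨x, hx, rfl⟩ _ ⟨y, hy, rfl⟩
  have h1 := dist_triangle4 (W x) x y (W y)
  have h2 := Metric.dist_le_diam_of_mem hD hx hy
  have h3 := hWM x
  have h4 := hWM y
  rw [dist_comm] at h4
  linarith

/-- Iterates of a lift of a distortion element, in a group of homeomorphisms with lifts at bounded
distance from the identity, enlarge bounded sets sublinearly. -/
theorem tendsto_diam_image_pow_div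
    (hiso : ∀ γ : X ≃ₜ X, (∀ x, p (γ x) = p x) → Isometry γ)
    {D : Set X} (hD : Bornology.IsBounded D) {G : Subgroup (S ≃ₜ S)}
    (hG : G ≤ boundedLiftSubgroup p) {f : G} (hf : IsDistortionElement f) {F : X ≃ₜ X}
    (hF : ∀ x, p (F x) = (f : S ≃ₜ S) (p x)) :
    Tendsto (fun n : ℕ => Metric.diam (⇑(F ^ n) '' D) / (n : ℝ)) atTop (𝓝 0) := by
  obtain ⟨T, hT, hfT, hlim⟩ := hf
  choose M hM using fun g : G => (hG g.2 : ∃ M, HasLiftWithin p M (g : S ≃ₜ S))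
  obtain ⟨B, hB⟩ := (hT.image M).bddAbove
  -- The maximum with `0` keeps the bound nonnegative even if `T` is empty.
  set C := max B 0
  have hC : 0 ≤ C := le_max_right _ _
  have hTC : ∀ s ∈ T, HasLiftWithin p C (s : S ≃ₜ S) := fun s hs =>
    (hM s).mono ((hB (mem_image_of_mem M hs)).trans (le_max_left _ _))
  have hpow (n : ℕ) : HasLiftWithin p (wordLength T (f ^ n) * C) ((f ^ n : G) : S ≃ₜ S) := by
    obtain ⟨w, hlen, hw, hprod⟩ := exists_list_length_eq_wordLength (pow_mem hfT n)
    have h := HasLiftWithin.list_prod (p := p) (M := C) (w.map G.subtype) fun s hs => by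
      obtain ⟨t, ht, rfl⟩ := List.mem_map.1 hs
      rcases hw t ht with h | h
      · exact hTC t h
      · simpa using (hTC _ h).inv
    rwa [← map_list_prod, hprod, List.length_map, hlen] at h
  have hFpow (n : ℕ) : ∀ x, p ((F ^ n) x) = ((f ^ n : G) : S ≃ₜ S) (p x) := by
    induction n with
    | zero => exact fun x => rfl
    | succ n ih =>
      intro x
      rw [pow_succ, pow_succ]
      change p ((F ^ n) (F x)) = ((f ^ n : G) : S ≃ₜ S) ((f : S ≃ₜ S) (p x))
      rw [ih, hF]
  have hbound (n : ℕ) : Metric.diam (⇑(F ^ n) '' D) / (n : ℝ) ≤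
      Metric.diam D / n + 2 * C * ((wordLength T (f ^ n) : ℝ) / n) := by
    have h := diam_image_le_of_hasLiftWithin hiso hD (by positivity) (hpow n) (hFpow n)
    calc _ ≤ (Metric.diam D + 2 * (wordLength T (f ^ n) * C)) / (n : ℝ) := by gcongr
      _ = _ := by ring
  refine squeeze_zero (fun n => div_nonneg Metric.diam_nonneg n.cast_nonneg) hbound ?_
  simpa using (tendsto_const_div_atTop_nhds_zero_nat (Metric.diam D)).add (hlim.const_mul (2 * C))

end BoundedLift

/-! ### Coverings by simply connected spaces -/

section Covering

/-- The local homeomorphisms serve as charts of `X` modelled on `S`. The lifting criterion in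
`exists_deck` needs this property of the total space. -/
theorem _root_.IsLocalHomeomorph.locallyPathConnectedSpace {X S : Type*} [TopologicalSpace X]
    [TopologicalSpace S] [LocallyPathConnectedSpace S] {p : X → S} (hp : IsLocalHomeomorph p) :
    LocallyPathConnectedSpace X :=
  letI : ChartedSpace S X :=
    { atlas := range fun x => (hp x).choose
      chartAt x := (hp x).choose
      mem_chart_source x := (hp x).choose_spec.1
      chart_mem_atlas x := mem_range_self x }
  ChartedSpace.locallyPathConnectedSpace S X

/-- The deck transformations of a simply connected covering act transitively on fibres. -/
theorem _root_.IsCoveringMap.exists_deck {X S : Type*} [TopologicalSpace X] [TopologicalSpace S]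
    [SimplyConnectedSpace X] [LocallyPathConnectedSpace X] {p : X → S} (hp : IsCoveringMap p)
    {x y : X} (hxy : p x = p y) : ∃ γ : X ≃ₜ X, (∀ z, p (γ z) = p z) ∧ γ x = y := by
  have key (a b : X) (h : p a = p b) : ∃ F : C(X, X), F a = b ∧ ∀ z, p (F z) = p z := by
    obtain ⟨F, ⟨hF, hpF⟩, -⟩ :=
      hp.existsUnique_continuousMap_lifts ⟨p, hp.continuous⟩ a b h.symm
    exact ⟨F, hF, congrFun hpF⟩
  obtain ⟨F, hFx, hF⟩ := key x y hxy
  obtain ⟨G, hGy, hG⟩ := key y x hxy.symm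
  have hGF : G ∘ F = id := hp.eq_of_comp_eq (by fun_prop) continuous_id
    (funext fun z => by simp [hF, hG]) x (by simp [hFx, hGy])
  have hFG : F ∘ G = id := hp.eq_of_comp_eq (by fun_prop) continuous_id
    (funext fun z => by simp [hF, hG]) y (by simp [hFx, hGy])
  exact ⟨⟨⟨F, G, congrFun hGF, congrFun hFG⟩, F.continuous, G.continuous⟩, hF, hFx⟩

variable {X S : Type*} [MetricSpace X] [TopologicalSpace S] {p : X → S}

/-- If `f` moves the points of the base so little that every `f (p x)` lifts to a point at distance
less than `r` from `x`, where `p` is injective on balls of radius `2 * r`, then these points define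
a lift of `f`. -/
theorem hasLiftWithin_of_injOn_ball (hp : IsLocalHomeomorph p) {r : ℝ}
    (hinj : ∀ x, InjOn p (Metric.ball x (2 * r))) {f : S ≃ₜ S}
    (hf : ∀ x, ∃ z, dist z x < r ∧ p z = f (p x))
    (hf' : ∀ x, ∃ z, dist z x < r ∧ p z = f.symm (p x)) : HasLiftWithin p r f := by
  have hcont (f : S ≃ₜ S) (F : X → X) (hFr : ∀ x, dist (F x) x < r)
      (hF : ∀ x, p (F x) = f (p x)) : Continuous F := by
    refine continuous_iff_continuousAt.2 fun x => ?_
    let e := hp.localInverseAt (F x)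
    have hsource : f (p x) ∈ e.source := hF x ▸ hp.apply_self_mem_localInverseAt_source
    have hex : e (f (p x)) = F x := hF x ▸ hp.localInverseAt_apply_self
    have hfp : Continuous fun y => f (p y) := f.continuous.comp hp.continuous
    have hc : ContinuousAt (fun y => e (f (p y))) x :=
      ContinuousAt.comp (f := fun y => f (p y)) (g := e) (e.continuousAt hsource)
        hfp.continuousAt
    have h1 : ∀ᶠ y in 𝓝 x, f (p y) ∈ e.source :=
      hfp.continuousAt.eventually (e.open_source.mem_nhds hsource)
    have h2 : ∀ᶠ y in 𝓝 x, dist (e (f (p y))) y < r :=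
      (hc.dist continuousAt_id).eventually_lt continuousAt_const (by simpa [hex] using hFr x)
    -- Near `x`, both `F y` and the local section through `F x` lie over `f (p y)` and within `r` of
    -- `y`, so they agree.
    have heq : F =ᶠ[𝓝 x] fun y => e (f (p y)) := by
      filter_upwards [h1, h2] with y hy1 hy2
      have hy := hFr y
      have h0 := dist_nonneg (x := F y) (y := y)
      refine hinj y (Metric.mem_ball.2 (by linarith)) (Metric.mem_ball.2 (by linarith)) ?_
      rw [hF, hp.apply_localInverseAt_of_mem hy1]
    exact hc.congr heq.symm
  have hcancel (f : S ≃ₜ S) (F G : X → X) (hFr : ∀ x, dist (F x) x < r)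
      (hF : ∀ x, p (F x) = f (p x)) (hGr : ∀ x, dist (G x) x < r)
      (hG : ∀ x, p (G x) = f.symm (p x)) (x : X) : G (F x) = x := by
    have h0 := dist_nonneg (x := F x) (y := x)
    have h1 := dist_triangle (G (F x)) (F x) x
    have h2 := hGr (F x)
    have h3 := hFr x
    refine hinj x (Metric.mem_ball.2 (by linarith)) (Metric.mem_ball_self (by linarith)) ?_
    rw [hG, hF, Homeomorph.symm_apply_apply]
  choose F hFr hF using hf
  choose G hGr hG using hf'
  exact ⟨⟨⟨F, G, hcancel f F G hFr hF hGr hG, hcancel f.symm G F hGr hG hFr hF⟩,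
    hcont f F hFr hF, hcont f.symm G hGr hG⟩, hF, fun x => (hFr x).le⟩

/-- For a cocompact covering by a simply connected space with isometric deck transformations, the
homeomorphisms of the base close to the identity have lifts at bounded distance from the
identity. -/
theorem boundedLiftSubgroup_mem_nhds_one [SimplyConnectedSpace X] [LocallyPathConnectedSpace X]
    (hp : IsCoveringMap p) (hiso : ∀ γ : X ≃ₜ X, (∀ x, p (γ x) = p x) → Isometry γ)
    {D : Set X} (hD : IsCompact D) (hDp : p '' D = univ) :
    (boundedLiftSubgroup p : Set (S ≃ₜ S)) ∈ 𝓝 1 := by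
  have hloc := hp.isLocalHomeomorph
  have htranslate (x : X) : ∃ γ : X ≃ₜ X, (∀ z, p (γ z) = p z) ∧ Isometry γ ∧ ∃ d ∈ D, γ d = x := by
    obtain ⟨d, hd, hdx⟩ : p x ∈ p '' D := hDp ▸ mem_univ _
    obtain ⟨γ, hγ, hγd⟩ := hp.exists_deck hdx
    exact ⟨γ, hγ, hiso γ hγ, d, hd, hγd⟩
  -- A Lebesgue number gives a uniform injectivity radius on `D`; deck isometries carry it to all of
  -- `X`.
  obtain ⟨δ, hδ, hball⟩ := lebesgue_number_lemma_of_metric hD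
    (c := fun x => (hloc.localInverseAt x).target)
    (fun x => (hloc.localInverseAt x).open_target)
    (fun x _ => mem_iUnion.2 ⟨x, hloc.self_mem_localInverseAt_target⟩)
  obtain ⟨r, hr, rfl⟩ : ∃ r > 0, δ = 2 * r := ⟨δ / 2, by positivity, by ring⟩
  have hinj (x : X) : InjOn p (Metric.ball x (2 * r)) := by
    obtain ⟨γ, hγ, hγiso, d, hd, rfl⟩ := htranslate x
    obtain ⟨i, hi⟩ := hball d hd
    intro y hy z hz hyz
    obtain ⟨y, rfl⟩ := γ.surjective y
    obtain ⟨z, rfl⟩ := γ.surjective z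
    rw [Metric.mem_ball, hγiso.dist_eq] at hy hz
    rw [hγ, hγ] at hyz
    rw [hloc.injOn_localInverseAt_target (hi hy) (hi hz) hyz]
  obtain ⟨t, -, ht⟩ := hD.elim_finite_subcover_image (b := D)
    (c := fun d => Metric.ball d (r / 4)) (fun _ _ => Metric.isOpen_ball)
    (fun d hd => mem_biUnion hd (Metric.mem_ball_self (by positivity)))
  obtain ⟨htfin, hcover⟩ := ht
  -- Finitely many compact-open conditions. The radii satisfy `r / 4 + r / 2 < r`.
  have hnhds : ∀ᶠ f : S ≃ₜ S in 𝓝 1, ∀ d ∈ t,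
      MapsTo f (p '' (D ∩ Metric.closedBall d (r / 4))) (p '' Metric.ball d (r / 2)) := by
    rw [eventually_all_finite htfin]
    intro d _
    have hcoe : Continuous fun f : S ≃ₜ S => (f : C(S, S)) := continuous_induced_dom
    refine hcoe.continuousAt.eventually (ContinuousMap.eventually_mapsTo
      ((hD.inter_right Metric.isClosed_closedBall).image hp.continuous)
      (hloc.isOpenMap _ Metric.isOpen_ball) ?_)
    rintro _ ⟨x, hx, rfl⟩
    exact ⟨x, Metric.closedBall_subset_ball (by linarith) hx.2, rfl⟩
  filter_upwards [hnhds] with f hf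
  have hclose (x : X) : ∃ z, dist z x < r ∧ p z = f (p x) := by
    obtain ⟨γ, hγ, hγiso, x, hx, rfl⟩ := htranslate x
    obtain ⟨d, hd, hxd⟩ := mem_iUnion₂.1 (hcover hx)
    obtain ⟨z, hz, hpz⟩ := hf d hd ⟨x, ⟨hx, Metric.ball_subset_closedBall hxd⟩, rfl⟩
    refine ⟨γ z, ?_, by rw [hγ, hγ, hpz]⟩
    rw [hγiso.dist_eq]
    rw [Metric.mem_ball] at hz hxd
    have := dist_triangle_right z x d
    linarith
  refine ⟨r, hasLiftWithin_of_injOn_ball hloc hinj hclose fun x => ?_⟩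
  -- The inverse needs no further condition: `hclose` at a point `w` over `f.symm (p x)` gives `z`
  -- over `p x`, and the deck isometry taking `z` to `x` takes `w` near `x`.
  obtain ⟨w, -, hw⟩ : f.symm (p x) ∈ p '' D := hDp ▸ mem_univ _
  obtain ⟨z, hz, hpz⟩ := hclose w
  rw [hw, Homeomorph.apply_symm_apply] at hpz
  obtain ⟨γ, hγ, rfl⟩ := hp.exists_deck hpz
  refine ⟨γ w, ?_, by rw [hγ, hw]⟩
  rwa [(hiso γ hγ).dist_eq, dist_comm]

end Covering

/-! ### Identity components -/

section IdentityComponent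

variable {X : Type*} [TopologicalSpace X]

/-- A group of homeomorphisms which is a neighbourhood of the identity is open and closed. -/
theorem isClopen_of_mem_nhds_one {K : Subgroup (X ≃ₜ X)} (hK : (K : Set (X ≃ₜ X)) ∈ 𝓝 1) :
    IsClopen (K : Set (X ≃ₜ X)) := by
  -- Each coset `f K` is a neighbourhood of `f`, by continuity of left translations alone; so `K`
  -- and its complement are open.
  have hnhds (f : X ≃ₜ X) : ∀ᶠ g in 𝓝 f, f⁻¹ * g ∈ K :=
    (continuous_mul_left_homeo f⁻¹).continuousAt.eventually (by beta_reduce; rw [inv_mul_cancel]; exact hK)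
  refine ⟨⟨isOpen_iff_mem_nhds.2 fun f hf => ?_⟩, isOpen_iff_mem_nhds.2 fun f hf => ?_⟩
  · filter_upwards [hnhds f] with g hg hgK
    exact hf (by simpa using K.mul_mem hgK (K.inv_mem hg))
  · filter_upwards [hnhds f] with g hg
    simpa using K.mul_mem hf hg

/-- A connected set meeting a clopen set lies inside it. As `H` is arbitrary, this covers `Homeo₀`
and `Homeo₀Rel` alike. -/
theorem identityComponent_le {K : Subgroup (X ≃ₜ X)} (hK : (K : Set (X ≃ₜ X)) ∈ 𝓝 1)
    (H : Subgroup (X ≃ₜ X)) : identityComponent H ≤ K := fun _ hf =>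
  isPreconnected_connectedComponentIn.subset_isClopen (isClopen_of_mem_nhds_one hK)
    ⟨1, mem_connectedComponentIn H.one_mem, K.one_mem⟩ hf

end IdentityComponent

namespace PlanarUniversalCover

variable {S : Type*} [TopologicalSpace S] (P : PlanarUniversalCover S)

theorem IsIsotopyLift.isLift {P : PlanarUniversalCover S} {A : Set S} {f : S ≃ₜ S}
    {F : P.total ≃ₜ P.total} (h : P.IsIsotopyLift A f F) : P.IsLift f F := by
  obtain ⟨φ, Φ, hφ, -, hlift, -, rfl⟩ := h
  exact hφ.map_one ▸ hlift 1

/-- In the identity component of a group of homeomorphisms of a surface, iterates of a lift of a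
distortion element enlarge fundamental domains sublinearly. -/
theorem tendsto_diam_image_pow_div [LocallyPathConnectedSpace S] {D : Set P.total}
    (hD : P.IsFundamentalDomain D) {H : Subgroup (S ≃ₜ S)} {f : identityComponent H}
    (hf : IsDistortionElement f) {F : P.total ≃ₜ P.total} (hF : P.IsLift f F) :
    Tendsto (fun n : ℕ => Metric.diam (⇑(F ^ n) '' D) / (n : ℝ)) atTop (𝓝 0) := by
  have := P.simplyConnected
  have := P.isCoveringMap.isLocalHomeomorph.locallyPathConnectedSpace
  exact SurfaceDistortion.tendsto_diam_image_pow_div P.isometry_of_deck hD.isCompact.isBounded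
    (identityComponent_le (boundedLiftSubgroup_mem_nhds_one P.isCoveringMap P.isometry_of_deck
      hD.isCompact hD.image_proj) H) hf hF

end PlanarUniversalCover

end SurfaceDistortion

/-- `S` is a compact connected surface, possibly with boundary, whose universal cover `P` is realised
in the euclidean or hyperbolic plane with isometric deck transformations, and `D` is a fundamental
domain. Orientability of `S`, and `S` not being a disc or a sphere, are not needed as hypotheses. -/
theorem proposition1 {S : Type*} [TopologicalSpace S] [T2Space S] [CompactSpace S]
    [ConnectedSpace S] [ChartedSpace (EuclideanHalfSpace 2) S]
    (P : SurfaceDistortion.PlanarUniversalCover S)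
    (D : Set P.total) (hD : P.IsFundamentalDomain D) :
    (∀ (f : SurfaceDistortion.Homeo₀ S) (F : P.total ≃ₜ P.total),
      P.IsIsotopyLift ∅ (f : S ≃ₜ S) F →
      SurfaceDistortion.IsDistortionElement f →
      Tendsto (fun n : ℕ => Metric.diam (⇑(F ^ n) '' D) / (n : ℝ)) atTop (𝓝 0)) ∧
    (∀ (f : SurfaceDistortion.Homeo₀Rel S) (F : P.total ≃ₜ P.total),
      P.IsIsotopyLift (SurfaceDistortion.surfaceBoundary S) (f : S ≃ₜ S) F →
      SurfaceDistortion.IsDistortionElement f →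
      Tendsto (fun n : ℕ => Metric.diam (⇑(F ^ n) '' D) / (n : ℝ)) atTop (𝓝 0)) := by
  have := ChartedSpace.locallyPathConnectedSpace (EuclideanHalfSpace 2) S
  exact ⟨fun _ _ hF hf => P.tendsto_diam_image_pow_div hD hf hF.isLift,
    fun _ _ hF hf => P.tendsto_diam_image_pow_div hD hf hF.isLift⟩
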